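/- Let $(X,\mathcal A,\mu)$ be a finite nonatomic measure space, let $U\subset\mathbb R^m$ be a convex compact set with more than one element, and let $$\mathcal U:=\{u\in L^1(X)^m:\ u(x)\in U\ \text{for a.e. }x\in X\}.$$ Let $\mathcal J:\mathcal U\to\mathbb R$ be weakly sequentially continuous, i.e. $\mathcal J(u_n)\to\mathcal J(u)$ whenever $u_n,u\in\mathcal U$ and $u_n\rightharpoonup u$ weakly in $L^1(X)^m$. Write $|u|_{L^1}=\int_X|u(x)|\,d\mu(x)$ and $|\xi|_{L^\infty}=\operatorname{ess\,sup}_{x\in X}|\xi(x)|$, with the Euclidean norm on $\mathbb R^m$, and $\xi u:=\int_X\xi(x)\cdot u(x)\,d\mu(x)$ for $\xi\in L^\infty(X)^m$, $u\in L^1(X)^m$. For $u^*\in\mathcal U$ define the following; suprema are taken in $[0,+\infty]$. * The minimality radius $\bar r_{u^*}:=\sup\{\delta\ge0:\ \mathcal J(u^*)\le\mathcal J(u)\text{ for all }u\in\mathcal U\text{ with }|u-u^*|_{L^1}\le\delta\}$ and the strict minimality radius $\hat r_{u^*}:=\sup\{\delta\ge0:\ \mathcal J(u^*)<\mathcal J(u)\text{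 for all }u\in\mathcal U\setminus\{u^*\}\text{ with }|u-u^*|_{L^1}\le\delta\}$. The element $u^*$ is a local minimizer if $\bar r_{u^*}>0$, and a strict local minimizer if $\hat r_{u^*}>0$. * The element $u^*$ is bang-bang if $u^*(x)$ is an extreme point of $U$ for a.e. $x\in X$. * For $\gamma>0$ and $\xi\in L^\infty(X)^m$, $\mathcal S_{u^*,\gamma}(\xi)$ is the set of minimizers of $u\mapsto\mathcal J(u)-\xi u$ over $\{u\in\mathcal U:\ |u-u^*|_{L^1}\le\gamma\}$. * A number $\gamma>0$ has the stability property at $u^*$ if for every $\varepsilon>0$ there is $\delta>0$ such that, for all $\xi\in L^\infty(X)^m$ and all $u\in\mathcal S_{u^*,\gamma}(\xi)$, $|\xi|_{L^\infty}<\delta$ implies $|u-u^*|_{L^1}<\varepsilon$. The problem $\min_{u\in\mathcal U}\mathcal J(u)$ is locally stable at $u^*$ if some $\gamma>0$ has the stability property at $u^*$. The stability radius $\hat\gamma_{u^*}$ is the supremum of all such $\gamma$. **Theorem.** Let $u^*\in\mathcal U$ be a local minimizer. The following statements are equivalent. 1. The problem $\min_{u\in\mathcal U}\mathcal J(u)$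 is locally stable at $u^*$. 2. $u^*$ is a bang-bang strict local minimizer. Moreover, if the problem is locally stable at $u^*$, then $\hat\gamma_{u^*}=\hat r_{u^*}$. -/

import Mathlib

open MeasureTheory Filter Topology
open scoped ENNReal NNReal

noncomputable section

namespace AffineControl

/-- A measure is nonatomic if every measurable set of positive measure contains a measurable
subset of strictly smaller positive measure. -/
def Nonatomic {X : Type*} [MeasurableSpace X] (μ : Measure X) : Prop :=
  ∀ s : Set X, MeasurableSet s → 0 < μ s → ∃ t ⊆ s, MeasurableSet t ∧ 0 < μ t ∧ μ t < μ s

/-- `L¹(X)^m`, with norm `∫ |u(x)| dμ(x)`, where `|·|` is the Euclidean norm. -/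
abbrev L1 {X : Type*} [MeasurableSpace X] (μ : Measure X) (m : ℕ) : Type _ :=
  Lp (EuclideanSpace ℝ (Fin m)) 1 μ

/-- `L^∞(X)^m`, with the essential supremum of the Euclidean norm. -/
abbrev Linf {X : Type*} [MeasurableSpace X] (μ : Measure X) (m : ℕ) : Type _ :=
  Lp (EuclideanSpace ℝ (Fin m)) ∞ μ

variable {X : Type*} [MeasurableSpace X] {μ : Measure X} {m : ℕ}
  {U : Set (EuclideanSpace ℝ (Fin m))}

/-- The feasible set: all `u ∈ L¹(X)^m` with `u(x) ∈ U` for almost every `x`. -/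
def feasibleSet (μ : Measure X) (U : Set (EuclideanSpace ℝ (Fin m))) : Set (L1 μ m) :=
  {u | ∀ᵐ x ∂μ, u x ∈ U}

/-- The action `ξ u = ∫ ξ(x) · u(x) dμ(x)` of `ξ ∈ L^∞(X)^m` on `u ∈ L¹(X)^m`. -/
def pairing (ξ : Linf μ m) (u : L1 μ m) : ℝ :=
  ∫ x, inner ℝ (ξ x) (u x) ∂μ

/-- Weak sequential continuity of a functional on the feasible set, with respect to the weak
topology of `L¹(X)^m`. -/
def WeaklySeqContinuous (J : feasibleSet μ U → ℝ) : Prop :=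
  ∀ (u : ℕ → feasibleSet μ U) (v : feasibleSet μ U),
    Tendsto (fun n => toWeakSpace ℝ (L1 μ m) (u n : L1 μ m)) atTop
      (𝓝 (toWeakSpace ℝ (L1 μ m) (v : L1 μ m))) →
    Tendsto (fun n => J (u n)) atTop (𝓝 (J v))

/-- Almost all values are extreme points of `U`. -/
def IsBangBang (u : feasibleSet μ U) : Prop :=
  ∀ᵐ x ∂μ, (u : L1 μ m) x ∈ Set.extremePoints ℝ U

/-- The minimality radius, with values in `[0, ∞]`. -/
def minimalityRadius (J : feasibleSet μ U → ℝ) (v : feasibleSet μ U) : ℝ≥0∞ :=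
  ⨆ (δ : ℝ≥0) (_ : ∀ u : feasibleSet μ U, ‖(u : L1 μ m) - v‖ ≤ δ → J v ≤ J u), (δ : ℝ≥0∞)

/-- The strict minimality radius, with values in `[0, ∞]`. -/
def strictMinimalityRadius (J : feasibleSet μ U → ℝ) (v : feasibleSet μ U) : ℝ≥0∞ :=
  ⨆ (δ : ℝ≥0) (_ : ∀ u : feasibleSet μ U, u ≠ v → ‖(u : L1 μ m) - v‖ ≤ δ → J v < J u),
    (δ : ℝ≥0∞)

def IsLocalMinimizer (J : feasibleSet μ U → ℝ) (v : feasibleSet μ U) : Prop :=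
  0 < minimalityRadius J v

def IsStrictLocalMinimizer (J : feasibleSet μ U → ℝ) (v : feasibleSet μ U) : Prop :=
  0 < strictMinimalityRadius J v

/-- The localized solution mapping: all minimizers of `J(u) - ξ u` over the feasible `u` with
`‖u - v‖ ≤ γ`. -/
def localizedSolutions (J : feasibleSet μ U → ℝ) (v : feasibleSet μ U) (γ : ℝ≥0)
    (ξ : Linf μ m) : Set (feasibleSet μ U) :=
  {u | ‖(u : L1 μ m) - v‖ ≤ γ ∧
    ∀ w : feasibleSet μ U, ‖(w : L1 μ m) - v‖ ≤ γ →
      J u - pairing ξ (u : L1 μ m) ≤ J w - pairing ξ (w : L1 μ m)}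

/-- The stability property at the localization radius `γ`: for every `ε > 0` there is `δ > 0` such
that `‖ξ‖ < δ` forces all localized solutions to be within distance `ε` of `v`. -/
def StableWithRadius (J : feasibleSet μ U → ℝ) (v : feasibleSet μ U) (γ : ℝ≥0) : Prop :=
  ∀ ε : ℝ, 0 < ε → ∃ δ : ℝ, 0 < δ ∧ ∀ ξ : Linf μ m, ∀ u ∈ localizedSolutions J v γ ξ,
    ‖ξ‖ < δ → ‖(u : L1 μ m) - v‖ < ε

/-- Local stability at `v`. -/
def IsLocallyStable (J : feasibleSet μ U → ℝ) (v : feasibleSet μ U) : Prop :=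
  ∃ γ : ℝ≥0, 0 < γ ∧ StableWithRadius J v γ

/-- The stability radius, with values in `[0, ∞]`. -/
def stabilityRadius (J : feasibleSet μ U → ℝ) (v : feasibleSet μ U) : ℝ≥0∞ :=
  ⨆ (γ : ℝ≥0) (_ : 0 < γ ∧ StableWithRadius J v γ), (γ : ℝ≥0∞)

end AffineControl

end

/-! ### Convex geometry at extreme points. -/

namespace AffineControl

/-! The feasible set is weakly sequentially compact, so tilted problems on balls have solutions.

Stability with radius `γ`, tested with `ξ = 0`, says that the center `v` is the only minimizer on
the ball, hence a strict one (`StableWithRadius.lt`). Tested with a small `ξ` aligned with `u - v`,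
it gives the growth bound `c * (‖u - v‖ - ε) ≤ J u - J v` (`StableWithRadius.exists_growth`). If `v`
took nonextreme values on a set of positive measure, rapid oscillations along segments in `U` would
produce feasible functions at a fixed distance from functions near `v`, yet converging weakly to
them. Growth then keeps `J` above `J v` by a fixed amount, against weak continuity
(`StableWithRadius.isBangBang`).

Conversely, solutions for tilts tending to zero have a weak limit that minimizes `J` on the ball, so
it is `v` by strictness. Weak convergence to a bang-bang function is strong
(`tendsto_norm_sub_of_isBangBang`), which is stability (`IsBangBang.stableWithRadius`). Both
directions keep the same `γ`, whence the equality of radii. -/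

theorem isCompact_convexJoin {E : Type*} [AddCommGroup E] [Module ℝ E] [TopologicalSpace E]
    [ContinuousAdd E] [ContinuousSMul ℝ E] {s t : Set E} (hs : IsCompact s) (ht : IsCompact t) :
    IsCompact (convexJoin ℝ s t) := by
  have h : convexJoin ℝ s t =
      (fun q : ℝ × E × E => (1 - q.1) • q.2.1 + q.1 • q.2.2) '' (Set.Icc 0 1 ×ˢ s ×ˢ t) := by
    ext x
    simp only [mem_convexJoin, segment_eq_image, Set.mem_image, Set.mem_prod, Prod.exists]
    constructor
    · rintro ⟨a, ha, b, hb, θ, hθ, rfl⟩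
      exact ⟨θ, a, b, ⟨hθ, ha, hb⟩, rfl⟩
    · rintro ⟨θ, a, b, ⟨hθ, ha, hb⟩, rfl⟩
      exact ⟨a, ha, b, hb, θ, hθ, rfl⟩
  rw [h]
  exact (isCompact_Icc.prod (hs.prod ht)).image (by fun_prop)

/-- In finite dimension the convex hull of a compact set is compact. -/
theorem isCompact_convexHull {E : Type*} [AddCommGroup E] [Module ℝ E] [TopologicalSpace E]
    [ContinuousAdd E] [ContinuousSMul ℝ E] [FiniteDimensional ℝ E] {s : Set E}
    (hs : IsCompact s) : IsCompact (convexHull ℝ s) := by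
  classical
  -- `C k` consists of the convex combinations of at most `k` points of `s`; by Carathéodory it is
  -- the whole hull at `finrank + 1`. The extra `∪ s` starts the recursion, since a join with `∅` is
  -- empty.
  obtain ⟨C, hC0, hC1⟩ : ∃ C : ℕ → Set E, C 0 = ∅ ∧ ∀ k, C (k + 1) = convexJoin ℝ s (C k) ∪ s :=
    ⟨fun k => Nat.rec ∅ (fun _ t => convexJoin ℝ s t ∪ s) k, rfl, fun _ => rfl⟩
  have hC : ∀ k, IsCompact (C k) := fun k => by
    induction k with
    | zero => rw [hC0]; exact isCompact_empty
    | succ k ih => rw [hC1]; exact (isCompact_convexJoin hs ih).union hs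
  have hCs : ∀ k, C k ⊆ convexHull ℝ s := fun k => by
    induction k with
    | zero => rw [hC0]; exact Set.empty_subset _
    | succ k ih =>
      rw [hC1]
      exact Set.union_subset
        (convexJoin_subset (subset_convexHull ℝ s) ih (convex_convexHull ℝ s))
        (subset_convexHull ℝ s)
  have hmono : Monotone C := monotone_nat_of_le_succ fun k => by
    induction k with
    | zero => rw [hC0]; exact Set.empty_subset _
    | succ k ih =>
      rw [hC1, hC1 (k + 1)]
      exact Set.union_subset_union_left _ (convexJoin_mono_right ih)
  have hsub : ∀ t : Finset E, (t : Set E) ⊆ s → convexHull ℝ (t : Set E) ⊆ C t.card := by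
    intro t
    induction t using Finset.induction_on with
    | empty => intro _; simp
    | insert a t ha ih =>
      intro h
      rw [Finset.coe_insert, Set.insert_subset_iff] at h
      rw [Finset.card_insert_of_notMem ha, Finset.coe_insert, hC1]
      rcases t.eq_empty_or_nonempty with rfl | hne
      · simpa using Or.inr h.1
      · rw [convexHull_insert (by simpa using hne)]
        exact Set.subset_union_of_subset_left
          (convexJoin_mono (Set.singleton_subset_iff.2 h.1) (ih h.2)) _
  have : convexHull ℝ s = C (Module.finrank ℝ E + 1) := by
    refine Set.Subset.antisymm ?_ (hCs _)
    rw [convexHull_eq_union]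
    refine Set.iUnion_subset fun t => Set.iUnion_subset fun hts => Set.iUnion_subset fun hai => ?_
    refine (hsub t hts).trans (hmono ?_)
    have := hai.card_le_finrank_succ
    rw [Fintype.card_coe] at this
    exact this.trans (Nat.succ_le_succ (Submodule.finrank_le _))
  rw [this]
  exact hC _

/-- At an extreme point the distance function is dominated, up to `ε`, by a linear functional. -/
theorem exists_norm_sub_le_add_inner {E : Type*} [NormedAddCommGroup E] [InnerProductSpace ℝ E]
    [FiniteDimensional ℝ E] {U : Set E} (hconv : Convex ℝ U) (hU : IsCompact U) {y : E}
    (hy : y ∈ U.extremePoints ℝ) {ε : ℝ} (hε : 0 < ε) :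
    ∃ p : E, ∀ z ∈ U, ‖z - y‖ ≤ ε + inner ℝ p (z - y) := by
  -- The functional comes from separating `(y, ε)` from the convex hull of the graph of the distance
  -- to `y`.
  let S : Set (E × ℝ) := (fun z => (z, ‖z - y‖)) '' U
  have hS : IsCompact (convexHull ℝ S) := isCompact_convexHull (hU.image (by fun_prop))
  -- Extremality enters here: a convex combination lying over `y` uses only points over `y`, where
  -- the graph has height zero.
  let Q : Set (E × ℝ) := {q | q.1 ∈ U ∧ (q.1 = y → q.2 ≤ 0)}
  have hQ : Convex ℝ Q := by
    rw [convex_iff_forall_pos]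
    rintro ⟨z₁, t₁⟩ ⟨h₁, h₁'⟩ ⟨z₂, t₂⟩ ⟨h₂, h₂'⟩ a b ha hb hab
    refine ⟨hconv h₁ h₂ ha.le hb.le hab, fun h => ?_⟩
    obtain ⟨e₁, e₂⟩ := (mem_extremePoints.1 hy).2 z₁ h₁ z₂ h₂ ⟨a, b, ha, hb, hab, h⟩
    have := h₁' e₁
    have := h₂' e₂
    simp only [Prod.smul_mk, Prod.mk_add_mk, smul_eq_mul]
    simp only at *
    nlinarith
  have hSQ : convexHull ℝ S ⊆ Q := by
    refine convexHull_min ?_ hQ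
    rintro _ ⟨z, hz, rfl⟩
    exact ⟨hz, fun h => by simp only at h; simp [h]⟩
  have hnot : (y, ε) ∉ convexHull ℝ S := fun h => absurd ((hSQ h).2 rfl) (not_le.2 hε)
  obtain ⟨l, c, hl, hc⟩ := geometric_hahn_banach_closed_point (convex_convexHull ℝ S)
    hS.isClosed hnot
  have key : ∀ z ∈ U, l (z, 0) + ‖z - y‖ * l (0, 1) < l (y, 0) + ε * l (0, 1) := by
    intro z hz
    have h := (hl _ (subset_convexHull ℝ S ⟨z, hz, rfl⟩)).trans hc
    have e : ∀ (w : E) (t : ℝ), l (w, t) = l (w, 0) + t * l (0, 1) := fun w t => by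
      rw [← smul_eq_mul, ← map_smul, ← map_add]; simp
    rwa [e, e y] at h
  -- Testing `z = y` shows that the separating hyperplane is not vertical.
  have hs : 0 < l (0, 1) := by
    have := key y (extremePoints_subset hy)
    simp only [sub_self, norm_zero, zero_mul, add_zero, lt_add_iff_pos_right] at this
    exact pos_of_mul_pos_right this hε.le
  let q : StrongDual ℝ E := l.comp (ContinuousLinearMap.inl ℝ E ℝ)
  refine ⟨-(l (0, 1))⁻¹ • (InnerProductSpace.toDual ℝ E).symm q, fun z hz => ?_⟩
  rw [inner_smul_left, InnerProductSpace.toDual_symm_apply, map_sub]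
  have h := key z hz
  have : ‖z - y‖ * l (0, 1) ≤ (ε + -(l (0, 1))⁻¹ * (q z - q y)) * l (0, 1) := by
    have e : (ε + -(l (0, 1))⁻¹ * (q z - q y)) * l (0, 1) = ε * l (0, 1) - (q z - q y) := by
      field_simp; ring
    rw [e]
    simp only [q, ContinuousLinearMap.comp_apply, ContinuousLinearMap.inl_apply]
    linarith
  simpa using le_of_mul_le_mul_right this hs

end AffineControl

/-! ### Weak convergence and weak compactness of the feasible set. -/

namespace AffineControl

theorem tendsto_toWeakSpace_iff {ι E : Type*} [NormedAddCommGroup E] [NormedSpace ℝ E]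
    {l : Filter ι} {u : ι → E} {v : E} :
    Tendsto (fun n => toWeakSpace ℝ E (u n)) l (𝓝 (toWeakSpace ℝ E v)) ↔
      ∀ f : StrongDual ℝ E, Tendsto (fun n => f (u n)) l (𝓝 (f v)) := by
  refine WeakBilin.tendsto_iff_forall_eval_tendsto (topDualPairing ℝ E).flip fun x y h => ?_
  exact (SeparatingDual.eq_iff_forall_dual_eq (R := ℝ)).2 fun g => DFunLike.congr_fun h g

/-- A convex closed set contains all limits of weakly convergent sequences of its elements. -/
theorem mem_of_tendsto_weak {ι E : Type*} [NormedAddCommGroup E] [NormedSpace ℝ E] {l : Filter ι}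
    [l.NeBot] {s : Set E} (hconv : Convex ℝ s) (hs : IsClosed s) {u : ι → E} {v : E}
    (hu : ∀ n, u n ∈ s)
    (h : Tendsto (fun n => toWeakSpace ℝ E (u n)) l (𝓝 (toWeakSpace ℝ E v))) : v ∈ s := by
  -- Mazur: for convex sets, norm closure and weak closure agree.
  have hcl := hconv.toWeakSpace_closure ℝ
  have := mem_closure_of_tendsto h (Eventually.of_forall fun n => Set.mem_image_of_mem _ (hu n))
  rw [← hcl, hs.closure_eq] at this
  obtain ⟨w, hw, e⟩ := this
  rwa [← (toWeakSpace ℝ E).injective e]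

/-- Bounded sequences in Hilbert spaces have weakly convergent subsequences. -/
theorem exists_subseq_tendsto_inner {H : Type*} [NormedAddCommGroup H] [InnerProductSpace ℝ H]
    [CompleteSpace H] {u : ℕ → H} {R : ℝ} (hu : ∀ n, ‖u n‖ ≤ R) :
    ∃ v : H, ∃ φ : ℕ → ℕ, StrictMono φ ∧
      ∀ g : H, Tendsto (fun n => inner ℝ g (u (φ n))) atTop (𝓝 (inner ℝ g v)) := by
  -- Sequential Banach–Alaoglu needs separability, so the argument runs in the closed span of the
  -- sequence; testing with `g` amounts to testing with its projection onto `K`.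
  let K : Submodule ℝ H := (Submodule.span ℝ (Set.range u)).topologicalClosure
  have hKsep : TopologicalSpace.SeparableSpace K := by
    have : TopologicalSpace.IsSeparable (K : Set H) :=
      ((Set.countable_range u).isSeparable.span (R := ℝ)).closure
    exact this.separableSpace
  have hKc : CompleteSpace K := (Submodule.isClosed_topologicalClosure _).completeSpace_coe
  have huK : ∀ n, u n ∈ K := fun n =>
    Submodule.le_topologicalClosure _ (Submodule.subset_span ⟨n, rfl⟩)
  let w : ℕ → K := fun n => ⟨u n, huK n⟩
  obtain ⟨l, -, φ, hφ, hl⟩ := WeakDual.isSeqCompact_closedBall ℝ K 0 R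
    (x := fun n => StrongDual.toWeakDual (InnerProductSpace.toDual ℝ K (w n)))
    (fun n => by
      simp only [Set.mem_preimage, mem_closedBall_zero_iff]
      exact ((InnerProductSpace.toDual ℝ K).norm_map (w n)).trans_le (hu n))
  refine ⟨(InnerProductSpace.toDual ℝ K).symm (WeakDual.toStrongDual l), φ, hφ, fun g => ?_⟩
  have h := tendsto_iff_forall_eval_tendsto_topDualPairing.1 hl (K.orthogonalProjectionOnto g)
  have e : ∀ z : K, inner ℝ g (z : H) = inner ℝ z (K.orthogonalProjectionOnto g) := fun z => by
    rw [real_inner_comm, Submodule.inner_orthogonalProjectionOnto_eq_of_mem_left]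
  have e' := e ((InnerProductSpace.toDual ℝ K).symm (WeakDual.toStrongDual l))
  rw [InnerProductSpace.toDual_symm_apply] at e'
  rw [e']
  refine h.congr fun n => ?_
  exact (e (w (φ n))).symm

section Lp

variable {X : Type*} [MeasurableSpace X] {μ : Measure X} [IsFiniteMeasure μ] {E : Type*}
  [NormedAddCommGroup E] [NormedSpace ℝ E]

/-- The inclusion of `L²` into `L¹` for a finite measure. -/
noncomputable def lpTwoToLpOne (μ : Measure X) [IsFiniteMeasure μ] (E : Type*)
    [NormedAddCommGroup E] [NormedSpace ℝ E] : Lp E 2 μ →L[ℝ] Lp E 1 μ :=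
  LinearMap.mkContinuous
    { toFun := fun g => ((Lp.memLp g).mono_exponent one_le_two).toLp g
      map_add' := fun f g => by
        rw [← MemLp.toLp_add]
        exact MemLp.toLp_congr _ _ (Lp.coeFn_add f g)
      map_smul' := fun c f => by
        rw [RingHom.id_apply, ← MemLp.toLp_const_smul]
        exact MemLp.toLp_congr _ _ (Lp.coeFn_smul c f) }
    ((μ Set.univ ^ (1 / (1 : ℝ≥0∞).toReal - 1 / (2 : ℝ≥0∞).toReal)).toReal) fun g => by
      simp only [LinearMap.coe_mk, AddHom.coe_mk]
      rw [Lp.norm_toLp, Lp.norm_def, ← ENNReal.toReal_mul, mul_comm]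
      refine ENNReal.toReal_mono ?_ (eLpNorm_le_eLpNorm_mul_rpow_measure_univ one_le_two
        (Lp.aestronglyMeasurable g))
      refine ENNReal.mul_ne_top (Lp.eLpNorm_ne_top g) (ENNReal.rpow_ne_top_of_nonneg ?_
        (measure_ne_top μ _))
      norm_num

theorem coeFn_lpTwoToLpOne (g : Lp E 2 μ) : lpTwoToLpOne μ E g =ᵐ[μ] g :=
  MemLp.coeFn_toLp ((Lp.memLp g).mono_exponent one_le_two)

/-- Weak convergence in `L²` implies weak convergence in `L¹` for a finite measure. -/
theorem tendsto_weak_lpTwoToLpOne {F ι : Type*} [NormedAddCommGroup F] [InnerProductSpace ℝ F]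
    [CompleteSpace F] {l : Filter ι} {u : ι → Lp F 2 μ} {v : Lp F 2 μ}
    (h : ∀ g : Lp F 2 μ, Tendsto (fun n => inner ℝ g (u n)) l (𝓝 (inner ℝ g v))) :
    Tendsto (fun n => toWeakSpace ℝ (Lp F 1 μ) (lpTwoToLpOne μ F (u n))) l
      (𝓝 (toWeakSpace ℝ (Lp F 1 μ) (lpTwoToLpOne μ F v))) := by
  refine tendsto_toWeakSpace_iff.2 fun f => ?_
  have := h ((InnerProductSpace.toDual ℝ (Lp F 2 μ)).symm (f.comp (lpTwoToLpOne μ F)))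
  simpa only [InnerProductSpace.toDual_symm_apply, ContinuousLinearMap.comp_apply] using this

end Lp

variable {X : Type*} [MeasurableSpace X] {μ : Measure X} {m : ℕ}
  {U : Set (EuclideanSpace ℝ (Fin m))}

theorem convex_feasibleSet (hU : Convex ℝ U) : Convex ℝ (feasibleSet μ U) := by
  intro u hu v hv a b ha hb hab
  filter_upwards [hu, hv, Lp.coeFn_add (a • u) (b • v), Lp.coeFn_smul a u, Lp.coeFn_smul b v]
    with x h₁ h₂ e₁ e₂ e₃
  rw [e₁, Pi.add_apply, e₂, e₃]
  exact hU h₁ h₂ ha hb hab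

theorem isClosed_feasibleSet (hU : IsClosed U) : IsClosed (feasibleSet μ U) := by
  refine isClosed_of_closure_subset fun v hv => ?_
  obtain ⟨u, hu, hlim⟩ := mem_closure_iff_seq_limit.1 hv
  obtain ⟨φ, -, hφ⟩ := (tendstoInMeasure_of_tendsto_Lp hlim).exists_seq_tendsto_ae
  have : ∀ᵐ x ∂μ, ∀ n, u n x ∈ U := ae_all_iff.2 hu
  filter_upwards [hφ, this] with x h₁ h₂
  exact hU.mem_of_tendsto h₁ (Eventually.of_forall fun n => h₂ _)

/-- The feasible set is weakly sequentially compact. -/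
theorem exists_subseq_tendsto_weak [IsFiniteMeasure μ] (hconv : Convex ℝ U) (hU : IsCompact U)
    (u : ℕ → feasibleSet μ U) :
    ∃ v : feasibleSet μ U, ∃ φ : ℕ → ℕ, StrictMono φ ∧
      Tendsto (fun n => toWeakSpace ℝ (L1 μ m) (u (φ n) : L1 μ m)) atTop
        (𝓝 (toWeakSpace ℝ (L1 μ m) (v : L1 μ m))) := by
  obtain ⟨R, hR⟩ := hU.isBounded.exists_norm_le
  have hb : ∀ n, ∀ᵐ x ∂μ, ‖(u n : L1 μ m) x‖ ≤ R := fun n => by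
    have h : ∀ᵐ x ∂μ, (u n : L1 μ m) x ∈ U := (u n).2
    exact h.mono fun x hx => hR _ hx
  -- Boundedness of `U` lifts the sequence to a bounded one in the Hilbert space `L²`.
  have hmem : ∀ n, MemLp (u n : L1 μ m) 2 μ := fun n =>
    MemLp.of_bound (Lp.aestronglyMeasurable _) R (hb n)
  have hT : ∀ n, lpTwoToLpOne μ _ ((hmem n).toLp _) = (u n : L1 μ m) := fun n =>
    Lp.ext ((coeFn_lpTwoToLpOne _).trans (MemLp.coeFn_toLp _))
  have hbound : ∀ n, ‖(hmem n).toLp _‖ ≤ (μ.real Set.univ) ^ (2 : ℝ≥0∞).toReal⁻¹ * |R| := fun n =>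
    Lp.norm_le_of_ae_bound (abs_nonneg R) <| by
      filter_upwards [hb n, (hmem n).coeFn_toLp] with x h e
      rw [e]
      exact h.trans (le_abs_self R)
  obtain ⟨v, φ, hφ, h⟩ := exists_subseq_tendsto_inner hbound
  have hw := tendsto_weak_lpTwoToLpOne h
  simp only [hT] at hw
  exact ⟨⟨_, mem_of_tendsto_weak (convex_feasibleSet hconv) (isClosed_feasibleSet hU.isClosed)
    (fun n => (u (φ n)).2) hw⟩, φ, hφ, hw⟩

end AffineControl

/-! ### The pairing, and strong convergence to bang-bang functions. -/

namespace AffineControl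

variable {X : Type*} [MeasurableSpace X] {μ : Measure X} {m : ℕ}
  {U : Set (EuclideanSpace ℝ (Fin m))}

theorem ae_norm_le_norm (ξ : Linf μ m) : ∀ᵐ x ∂μ, ‖ξ x‖ ≤ ‖ξ‖ := by
  filter_upwards [ae_le_eLpNormEssSup (f := ξ) (μ := μ)] with x hx
  rw [Lp.norm_def, eLpNorm_exponent_top, ← toReal_enorm]
  exact ENNReal.toReal_mono (by simpa using Lp.eLpNorm_ne_top ξ) hx

theorem abs_inner_le_norm_mul (ξ : Linf μ m) (u : L1 μ m) :
    ∀ᵐ x ∂μ, ‖inner ℝ (ξ x) (u x)‖ ≤ ‖ξ‖ * ‖u x‖ := by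
  filter_upwards [ae_norm_le_norm ξ] with x hx
  exact (norm_inner_le_norm _ _).trans (by gcongr)

theorem integrable_inner (ξ : Linf μ m) (u : L1 μ m) :
    Integrable (fun x => inner ℝ (ξ x) (u x)) μ :=
  ((L1.integrable_coeFn u).norm.const_mul ‖ξ‖).mono'
    ((Lp.aestronglyMeasurable ξ).inner (Lp.aestronglyMeasurable u)) (abs_inner_le_norm_mul ξ u)

theorem abs_pairing_le (ξ : Linf μ m) (u : L1 μ m) : |pairing ξ u| ≤ ‖ξ‖ * ‖u‖ := by
  rw [L1.norm_eq_integral_norm, ← integral_const_mul]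
  exact norm_integral_le_of_norm_le ((L1.integrable_coeFn u).norm.const_mul ‖ξ‖)
    (abs_inner_le_norm_mul ξ u)

/-- The pairing with `ξ ∈ L^∞` as a continuous linear functional on `L¹`. -/
noncomputable def pairingCLM (ξ : Linf μ m) : StrongDual ℝ (L1 μ m) :=
  LinearMap.mkContinuous
    { toFun := pairing ξ
      map_add' := fun u v => by
        rw [pairing, pairing, pairing, ← integral_add (integrable_inner ξ u) (integrable_inner ξ v)]
        refine integral_congr_ae ?_
        filter_upwards [Lp.coeFn_add u v] with x hx
        rw [hx, Pi.add_apply, inner_add_right]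
      map_smul' := fun c u => by
        rw [RingHom.id_apply, smul_eq_mul, pairing, pairing, ← integral_const_mul]
        refine integral_congr_ae ?_
        filter_upwards [Lp.coeFn_smul c u] with x hx
        rw [hx, Pi.smul_apply, real_inner_smul_right] }
    ‖ξ‖ (abs_pairing_le ξ)

theorem pairingCLM_apply (ξ : Linf μ m) (u : L1 μ m) : pairingCLM ξ u = pairing ξ u := rfl

theorem pairing_sub (ξ : Linf μ m) (u v : L1 μ m) :
    pairing ξ (u - v) = pairing ξ u - pairing ξ v :=
  map_sub (pairingCLM ξ) u v

theorem pairing_zero (u : L1 μ m) : pairing (0 : Linf μ m) u = 0 := by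
  simpa using abs_pairing_le (0 : Linf μ m) u

/-- Every multiple of the `L¹` norm of `u` is realized by a pairing. -/
theorem exists_pairing_eq_mul_norm (u : L1 μ m) {c : ℝ} (hc : 0 ≤ c) :
    ∃ ξ : Linf μ m, ‖ξ‖ ≤ c ∧ pairing ξ u = c * ‖u‖ := by
  -- Where `u x = 0`, the convention `0⁻¹ = 0` is harmless.
  let f : X → EuclideanSpace ℝ (Fin m) := fun x => (c * ‖u x‖⁻¹) • u x
  have hfm : AEStronglyMeasurable f μ := by
    have := (Lp.stronglyMeasurable u).measurable
    exact (((this.norm.inv).const_mul c).smul this).aestronglyMeasurable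
  have hfb : ∀ x, ‖f x‖ ≤ c := fun x => by
    simp only [f, norm_smul, norm_mul, norm_inv, norm_norm, Real.norm_of_nonneg hc, mul_assoc]
    exact mul_le_of_le_one_right hc (inv_mul_le_one_of_le₀ le_rfl (norm_nonneg _))
  have hf : MemLp f ∞ μ := memLp_top_of_bound hfm c (Eventually.of_forall hfb)
  refine ⟨hf.toLp f, ?_, ?_⟩
  · rw [Lp.norm_toLp, eLpNorm_exponent_top]
    exact ENNReal.toReal_le_of_le_ofReal hc
      (eLpNormEssSup_le_of_ae_bound (Eventually.of_forall hfb))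
  · rw [pairing, L1.norm_eq_integral_norm, ← integral_const_mul]
    refine integral_congr_ae ?_
    filter_upwards [hf.coeFn_toLp] with x hx
    rw [hx]
    simp only [f]
    rw [real_inner_smul_left, real_inner_self_eq_norm_mul_norm]
    rcases eq_or_ne ‖u x‖ 0 with h | h
    · simp [h]
    · field_simp

/-- Weak convergence of feasible functions to a bang-bang function is strong convergence. -/
theorem tendsto_norm_sub_of_isBangBang [IsFiniteMeasure μ] (hconv : Convex ℝ U)
    (hU : IsCompact U) {u : ℕ → feasibleSet μ U} {v : feasibleSet μ U} (hv : IsBangBang v)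
    (h : Tendsto (fun n => toWeakSpace ℝ (L1 μ m) (u n : L1 μ m)) atTop
      (𝓝 (toWeakSpace ℝ (L1 μ m) (v : L1 μ m)))) :
    Tendsto (fun n => ‖(u n : L1 μ m) - v‖) atTop (𝓝 0) := by
  classical
  obtain ⟨R, hRpos, hR⟩ := hU.isBounded.exists_pos_norm_le
  have hdist : ∀ z ∈ U, ∀ y ∈ U, ‖z - y‖ ≤ 2 * R := fun z hz y hy =>
    (norm_sub_le z y).trans (by linarith [hR z hz, hR y hy])
  suffices H : ∀ ε : ℝ, 0 < ε → ∀ᶠ n in atTop,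
      ‖(u n : L1 μ m) - v‖ ≤ ε * (μ.real Set.univ + 1 + 2 * R) by
    refine tendsto_order.2 ⟨fun a ha => Eventually.of_forall fun n => ha.trans_le (norm_nonneg _),
      fun a ha => ?_⟩
    have hpos : 0 < μ.real Set.univ + 1 + 2 * R := by positivity
    filter_upwards [H (a / 2 / (μ.real Set.univ + 1 + 2 * R)) (by positivity)] with n hn
    rw [div_mul_cancel₀ _ hpos.ne'] at hn
    linarith
  intro ε hε
  -- Countably many slopes suffice, because replacing `p` by a nearby `d k` costs at most `ε / 2`. A
  -- slope can then be chosen measurably in `x` as the first index that works.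
  let d : ℕ → EuclideanSpace ℝ (Fin m) := TopologicalSpace.denseSeq _
  let T : ℕ → Set (EuclideanSpace ℝ (Fin m)) :=
    fun k => {y | ∀ z ∈ U, ‖z - y‖ ≤ ε + inner ℝ (d k) (z - y)}
  have hT : ∀ k, IsClosed (T k) := fun k => by
    simp only [T, Set.ofPred_forall]
    exact isClosed_biInter fun z _ => isClosed_le (by fun_prop) (by fun_prop)
  have hTex : ∀ y ∈ U.extremePoints ℝ, ∃ k, y ∈ T k := by
    intro y hy
    obtain ⟨p, hp⟩ := exists_norm_sub_le_add_inner hconv hU hy (half_pos hε)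
    obtain ⟨_, hk, k, rfl⟩ := Metric.dense_iff.1
      (TopologicalSpace.denseRange_denseSeq (EuclideanSpace ℝ (Fin m))) p (ε / 2 / (2 * R))
      (by positivity)
    refine ⟨k, fun z hz => ?_⟩
    have h₁ := hp z hz
    have h₂ : inner ℝ (p - d k) (z - y) ≤ ε / 2 := by
      refine (real_inner_le_norm _ _).trans ?_
      have hle := hdist z hz y hy.1
      rw [mem_ball_iff_norm'] at hk
      calc ‖p - d k‖ * ‖z - y‖ ≤ ε / 2 / (2 * R) * (2 * R) := by gcongr
        _ = ε / 2 := by field_simp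
    rw [inner_sub_left] at h₂
    linarith
  have hvm : Measurable (v : L1 μ m) := (Lp.stronglyMeasurable _).measurable
  -- The second alternative only makes `Nat.find` total; it fails almost everywhere.
  let P : X → ℕ → Prop := fun x k => (v : L1 μ m) x ∈ T k ∨ ∀ j, (v : L1 μ m) x ∉ T j
  have hP : ∀ x, ∃ k, P x k := fun x => by
    by_cases hx : ∃ j, (v : L1 μ m) x ∈ T j
    · exact hx.imp fun j hj => Or.inl hj
    · exact ⟨0, Or.inr (not_exists.1 hx)⟩
  have hPm : ∀ k, MeasurableSet {x | P x k} := fun k => by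
    have e : {x | P x k} = (v : L1 μ m) ⁻¹' T k ∪ ⋂ j, ((v : L1 μ m) ⁻¹' T j)ᶜ := by
      ext x
      simp [P]
    rw [e]
    exact (hvm (hT k).measurableSet).union
      (MeasurableSet.iInter fun j => (hvm (hT j).measurableSet).compl)
  let κ : X → ℕ := fun x => Nat.find (hP x)
  have hκ : Measurable κ := measurable_find hP hPm
  have hκT : ∀ᵐ x ∂μ, (v : L1 μ m) x ∈ T (κ x) := by
    filter_upwards [hv] with x hx
    obtain ⟨k, hk⟩ := hTex _ hx
    exact (Nat.find_spec (hP x)).resolve_right fun hn => hn k hk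
  -- The chosen slopes may be unbounded. Cutting them off beyond index `K` gives an `L^∞` function
  -- and costs at most `2 * R` on a set of measure at most `ε`.
  obtain ⟨K, hK⟩ : ∃ K : ℕ, μ.real {x | K < κ x} ≤ ε := by
    have hlim := tendsto_measure_iInter_atTop (μ := μ) (s := fun K : ℕ => {x | K < κ x})
      (fun K => (hκ measurableSet_Ioi).nullMeasurableSet)
      (fun a b hab x hx => lt_of_le_of_lt hab hx) ⟨0, measure_ne_top _ _⟩
    have hemp : ⋂ K : ℕ, {x | K < κ x} = ∅ := by
      ext x
      simp only [Set.mem_iInter, Set.mem_ofPred_eq, Set.mem_empty_iff_false, iff_false, not_forall]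
      exact ⟨κ x, lt_irrefl _⟩
    rw [hemp, measure_empty] at hlim
    obtain ⟨K, hK⟩ := (hlim.eventually (gt_mem_nhds (ENNReal.ofReal_pos.2 hε))).exists
    exact ⟨K, ENNReal.toReal_le_of_le_ofReal hε.le hK.le⟩
  have hKm : MeasurableSet {x | K < κ x} := hκ measurableSet_Ioi
  let q : ℕ → EuclideanSpace ℝ (Fin m) := fun k => if k ≤ K then d k else 0
  have hqb : ∀ k, ‖q k‖ ≤ ∑ j ∈ Finset.range (K + 1), ‖d j‖ := fun k => by
    by_cases hk : k ≤ K
    · simp only [q, if_pos hk]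
      exact Finset.single_le_sum (f := fun j => ‖d j‖) (fun _ _ => norm_nonneg _)
        (Finset.mem_range.2 (Nat.lt_succ_of_le hk))
    · simp only [q, if_neg hk, norm_zero]
      exact Finset.sum_nonneg fun _ _ => norm_nonneg _
  have hq : MemLp (fun x => q (κ x)) ∞ μ := memLp_top_of_bound
    ((measurable_from_nat (f := q)).comp hκ).aestronglyMeasurable _
    (Eventually.of_forall fun x => hqb _)
  let ξ : Linf μ m := hq.toLp _
  have hbound : ∀ n, ‖(u n : L1 μ m) - v‖ ≤
      ε * μ.real Set.univ + pairing ξ ((u n : L1 μ m) - v) + 2 * R * ε := by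
    intro n
    have hint₁ : Integrable (fun x => ε + inner ℝ (ξ x) (((u n : L1 μ m) - v : L1 μ m) x)) μ :=
      (integrable_const ε).add (integrable_inner ξ _)
    have hint₂ : Integrable (Set.indicator {x | K < κ x} (fun _ => 2 * R)) μ :=
      (integrable_const _).indicator hKm
    have hint : Integrable (fun x => ε + inner ℝ (ξ x) (((u n : L1 μ m) - v : L1 μ m) x) +
        Set.indicator {x | K < κ x} (fun _ => 2 * R) x) μ :=
      hint₁.add hint₂
    have hle : ‖(u n : L1 μ m) - v‖ ≤ ∫ x, (ε + inner ℝ (ξ x) (((u n : L1 μ m) - v : L1 μ m) x) +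
        Set.indicator {x | K < κ x} (fun _ => 2 * R) x) ∂μ := by
      rw [L1.norm_eq_integral_norm]
      refine integral_mono_ae (L1.integrable_coeFn _).norm hint ?_
      have hun : ∀ᵐ x ∂μ, (u n : L1 μ m) x ∈ U := (u n).2
      have hvU : ∀ᵐ x ∂μ, (v : L1 μ m) x ∈ U := v.2
      filter_upwards [hun, hvU, hκT, hq.coeFn_toLp, Lp.coeFn_sub (u n : L1 μ m) v]
        with x h₁ h₂ h₃ h₄ h₅
      simp only [ξ, h₄, h₅, Pi.sub_apply, q, Set.indicator, Set.mem_ofPred_eq]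
      by_cases hk : κ x ≤ K
      · rw [if_pos hk, if_neg (not_lt.2 hk), add_zero]
        exact h₃ _ h₁
      · rw [if_neg hk, if_pos (not_le.1 hk), inner_zero_left, add_zero]
        linarith [hdist _ h₁ _ h₂]
    refine hle.trans ?_
    rw [integral_add hint₁ hint₂, integral_add (integrable_const ε) (integrable_inner ξ _),
      integral_indicator hKm, integral_const, setIntegral_const]
    simp only [smul_eq_mul, pairing]
    nlinarith
  have hξ := tendsto_toWeakSpace_iff.1 h (pairingCLM ξ)
  simp only [pairingCLM_apply] at hξ
  have hξ' := hξ.sub_const (pairing ξ v)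
  rw [sub_self] at hξ'
  filter_upwards [hξ'.eventually (gt_mem_nhds hε)] with n hn
  have := hbound n
  rw [pairing_sub] at this
  nlinarith

end AffineControl

/-! ### Nonatomic measures and orthogonal signs. -/

namespace AffineControl

section Nonatomic

variable {X : Type*} [MeasurableSpace X] {μ : Measure X}

theorem Nonatomic.restrict (hμ : Nonatomic μ) {A : Set X} (hA : MeasurableSet A) :
    Nonatomic (μ.restrict A) := by
  intro s hs hpos
  rw [Measure.restrict_apply hs] at hpos ⊢
  obtain ⟨t, hts, ht, h₁, h₂⟩ := hμ (s ∩ A) (hs.inter hA) hpos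
  refine ⟨t, hts.trans Set.inter_subset_left, ht, ?_⟩
  rw [Measure.restrict_eq_self μ (hts.trans Set.inter_subset_right)]
  exact ⟨h₁, h₂⟩

/-- Of a proper part and its complement, one has at most half the measure; iterate. -/
theorem Nonatomic.exists_subset_le [IsFiniteMeasure μ] (hμ : Nonatomic μ) {s : Set X}
    (hs : MeasurableSet s) (hpos : 0 < μ.real s) {ε : ℝ} (hε : 0 < ε) :
    ∃ t ⊆ s, MeasurableSet t ∧ 0 < μ.real t ∧ μ.real t ≤ ε := by
  have halves : ∀ n : ℕ, ∃ t ⊆ s, MeasurableSet t ∧ 0 < μ.real t ∧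
      μ.real t ≤ (1 / 2) ^ n * μ.real s := by
    intro n
    induction n with
    | zero => exact ⟨s, le_rfl, hs, hpos, by simp⟩
    | succ n ih =>
      obtain ⟨t, hts, ht, h0, hn⟩ := ih
      obtain ⟨r, hrt, hr, h₁, h₂⟩ := hμ t ht (ENNReal.toReal_pos_iff.1 h0).1
      have h₁' : 0 < μ.real r := ENNReal.toReal_pos h₁.ne' (measure_ne_top _ _)
      have h₂' : μ.real r < μ.real t := ENNReal.toReal_strict_mono (measure_ne_top _ _) h₂
      have hd : μ.real (t \ r) = μ.real t - μ.real r := measureReal_sdiff hrt hr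
      rw [pow_succ]
      rcases le_total (μ.real r) (μ.real t / 2) with h | h
      · exact ⟨r, hrt.trans hts, hr, h₁', by linarith⟩
      · exact ⟨t \ r, Set.sdiff_subset.trans hts, ht.diff hr, by linarith, by linarith⟩
  have hlim : Tendsto (fun n : ℕ => (1 / 2 : ℝ) ^ n * μ.real s) atTop (𝓝 0) := by
    simpa using (tendsto_pow_atTop_nhds_zero_of_lt_one (r := (1 / 2 : ℝ)) (by norm_num)
      (by norm_num)).mul_const (μ.real s)
  obtain ⟨n, hn⟩ := (hlim.eventually (gt_mem_nhds hε)).exists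
  obtain ⟨t, h₁, h₂, h₃, h₄⟩ := halves n
  exact ⟨t, h₁, h₂, h₃, h₄.trans hn.le⟩

/-- **Sierpiński's theorem**: a finite nonatomic measure takes all intermediate values. -/
theorem Nonatomic.exists_subset_measure_eq [IsFiniteMeasure μ] (hμ : Nonatomic μ) {s : Set X}
    (hs : MeasurableSet s) {c : ℝ} (hc : 0 ≤ c) (hcs : c ≤ μ.real s) :
    ∃ t ⊆ s, MeasurableSet t ∧ μ.real t = c := by
  let Adm : Set (Set X) := {t | t ⊆ s ∧ MeasurableSet t ∧ μ.real t ≤ c}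
  -- Greedy choice: `t'` realizes at least half of the supremal gain in measure among admissible
  -- supersets of `t`.
  have step : ∀ t : Adm, ∃ t' : Adm, (t : Set X) ⊆ t' ∧
      ∀ r ∈ Adm, (t : Set X) ⊆ r → μ.real r + μ.real (t : Set X) ≤ 2 * μ.real (t' : Set X) := by
    intro t
    let V : Set ℝ := (fun r : Set X => μ.real r) '' {r | r ∈ Adm ∧ (t : Set X) ⊆ r}
    have hVne : V.Nonempty := ⟨_, t, ⟨t.2, le_rfl⟩, rfl⟩
    have hVb : BddAbove V := ⟨c, by rintro _ ⟨r, hr, rfl⟩; exact hr.1.2.2⟩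
    have htV : μ.real (t : Set X) ≤ sSup V := le_csSup hVb ⟨t, ⟨t.2, le_rfl⟩, rfl⟩
    have hV : ∀ r ∈ Adm, (t : Set X) ⊆ r → μ.real r ≤ sSup V := fun r hr htr =>
      le_csSup hVb ⟨r, ⟨hr, htr⟩, rfl⟩
    rcases htV.eq_or_lt with h | h
    · exact ⟨t, le_rfl, fun r hr htr => by linarith [hV r hr htr]⟩
    · obtain ⟨_, ⟨r', hr', rfl⟩, hlt⟩ := exists_lt_of_lt_csSup hVne
        (show (μ.real (t : Set X) + sSup V) / 2 < sSup V by linarith)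
      refine ⟨⟨r', hr'.1⟩, hr'.2, fun r hr htr => ?_⟩
      have := hV r hr htr
      simp only at hlt ⊢
      linarith
  choose nxt hsub hnxt using step
  let T : ℕ → Adm := fun n => nxt^[n] ⟨∅, Set.empty_subset _, MeasurableSet.empty, by simpa using hc⟩
  have hT : ∀ n, T (n + 1) = nxt (T n) := fun n => Function.iterate_succ_apply' _ _ _
  have hmono : Monotone fun n => (T n : Set X) :=
    monotone_nat_of_le_succ fun n => by rw [hT]; exact hsub _
  let t : Set X := ⋃ n, (T n : Set X)
  have hlim : Tendsto (fun n => μ.real (T n : Set X)) atTop (𝓝 (μ.real t)) :=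
    (ENNReal.tendsto_toReal (measure_ne_top μ t)).comp (tendsto_measure_iUnion_atTop hmono)
  have hts : t ⊆ s := Set.iUnion_subset fun n => (T n).2.1
  have htm : MeasurableSet t := MeasurableSet.iUnion fun n => (T n).2.2.1
  have htc : μ.real t ≤ c := le_of_tendsto' hlim fun n => (T n).2.2.2
  refine ⟨t, hts, htm, htc.antisymm (not_lt.1 fun hlt => ?_)⟩
  have hd : μ.real (s \ t) = μ.real s - μ.real t := measureReal_sdiff hts htm
  obtain ⟨r, hrs, hr, hr0, hrle⟩ := hμ.exists_subset_le (hs.diff htm) (by linarith)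
    (sub_pos.2 hlt)
  have hu : μ.real (t ∪ r) = μ.real t + μ.real r :=
    measureReal_union (Set.disjoint_sdiff_right.mono_right hrs) hr
  have hadm : t ∪ r ∈ Adm :=
    ⟨Set.union_subset hts (hrs.trans Set.sdiff_subset), htm.union hr, by linarith⟩
  -- The set `t ∪ r` competes at every stage, so in the limit the greedy inequality forces `μ.real r
  -- ≤ 0`.
  have hineq : ∀ n, μ.real (t ∪ r) + μ.real (T n : Set X) ≤ 2 * μ.real (T (n + 1) : Set X) :=
    fun n => by
      rw [hT]
      exact hnxt (T n) _ hadm ((Set.subset_iUnion (fun n => (T n : Set X)) n).trans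
        Set.subset_union_left)
  have := le_of_tendsto_of_tendsto' (hlim.const_add (μ.real (t ∪ r)))
    (((tendsto_add_atTop_iff_nat 1).2 hlim).const_mul 2) hineq
  linarith

/-- Every countable measurable partition can be halved simultaneously. -/
theorem Nonatomic.exists_map_restrict_eq [IsFiniteMeasure μ] (hμ : Nonatomic μ) {κ : X → ℕ}
    (hκ : Measurable κ) :
    ∃ E : Set X, MeasurableSet E ∧ (μ.restrict E).map κ = (μ.restrict Eᶜ).map κ := by
  have hm : ∀ k, MeasurableSet (κ ⁻¹' {k}) := fun k => hκ (measurableSet_singleton k)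
  have : ∀ k, ∃ t ⊆ κ ⁻¹' {k}, MeasurableSet t ∧ μ.real t = μ.real (κ ⁻¹' {k}) / 2 := fun k =>
    hμ.exists_subset_measure_eq (hm k) (by positivity)
      (half_le_self measureReal_nonneg)
  choose t hts htm ht using this
  refine ⟨⋃ k, t k, MeasurableSet.iUnion htm, Measure.ext_of_singleton fun k => ?_⟩
  rw [Measure.map_apply hκ (measurableSet_singleton k),
    Measure.map_apply hκ (measurableSet_singleton k), Measure.restrict_apply (hm k),
    Measure.restrict_apply (hm k)]
  have e : κ ⁻¹' {k} ∩ ⋃ j, t j = t k := by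
    ext x
    simp only [Set.mem_inter_iff, Set.mem_preimage, Set.mem_singleton_iff, Set.mem_iUnion]
    constructor
    · rintro ⟨hx, j, hj⟩
      have : κ x = j := hts j hj
      rwa [← hx, this]
    · exact fun hx => ⟨hts k hx, k, hx⟩
  have e' : κ ⁻¹' {k} ∩ (⋃ j, t j)ᶜ = κ ⁻¹' {k} \ t k := by
    rw [← Set.sdiff_eq, ← e, Set.sdiff_self_inter]
  rw [e, e', ← measureReal_eq_measureReal_iff, measureReal_sdiff (hts k) (htm k), ht]
  ring

/-- A finite nonatomic measure admits a sequence of pairwise orthogonal sign functions. -/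
theorem Nonatomic.exists_orthogonal_signs [IsFiniteMeasure μ] (hμ : Nonatomic μ) :
    ∃ r : ℕ → X → ℝ, (∀ n, Measurable (r n)) ∧ (∀ n x, r n x = 1 ∨ r n x = -1) ∧
      ∀ n k, n ≠ k → ∫ x, r n x * r k x ∂μ = 0 := by
  classical
  choose E hEm hE using fun κ : {κ : X → ℕ // Measurable κ} => hμ.exists_map_restrict_eq κ.2
  let sgn : {κ : X → ℕ // Measurable κ} → X → ℝ := fun κ x => if x ∈ E κ then 1 else -1
  -- The label `κ` records the past choices as binary digits. `E κ` halves every label class, and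
  -- the new digit tells the halves apart.
  let nxt : {κ : X → ℕ // Measurable κ} → {κ : X → ℕ // Measurable κ} := fun κ =>
    ⟨fun x => 2 * κ.1 x + if x ∈ E κ then 1 else 0,
      (κ.2.const_mul 2).add (Measurable.ite (hEm κ) measurable_const measurable_const)⟩
  let K : ℕ → {κ : X → ℕ // Measurable κ} := fun n => nxt^[n] ⟨fun _ => 0, measurable_const⟩
  have hK : ∀ n, K (n + 1) = nxt (K n) := fun n => Function.iterate_succ_apply' _ _ _
  -- Earlier signs are functions of the later label: read off the last digit, or drop it and
  -- recurse. The `n`th sign is balanced on each class of that label, which gives orthogonality.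
  have hfac : ∀ k n, k < n → ∃ g : ℕ → ℝ, (∀ j, |g j| ≤ 1) ∧ ∀ x, sgn (K k) x = g ((K n).1 x) := by
    intro k n hkn
    induction n, hkn using Nat.le_induction with
    | base =>
      refine ⟨fun j => if j % 2 = 1 then 1 else -1, fun j => ?_, fun x => ?_⟩
      · dsimp only
        split_ifs <;> simp
      rw [hK]
      by_cases hx : x ∈ E (K k)
      · simp [sgn, nxt, hx, Nat.add_mod]
      · simp [sgn, nxt, hx]
    | succ n _ ih =>
      obtain ⟨g, hg, hgx⟩ := ih
      refine ⟨fun j => g (j / 2), fun j => hg _, fun x => ?_⟩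
      rw [hgx, hK]
      congr 1
      simp only [nxt]
      split_ifs <;> omega
  have hmeas : ∀ n, Measurable (sgn (K n)) := fun n =>
    Measurable.ite (hEm _) measurable_const measurable_const
  have hlt : ∀ k n, k < n → ∫ x, sgn (K n) x * sgn (K k) x ∂μ = 0 := by
    intro k n hkn
    obtain ⟨g, hg, hgx⟩ := hfac k n hkn
    have hgm : Measurable fun x => g ((K n).1 x) := (measurable_from_nat (f := g)).comp (K n).2
    have hgi : Integrable (fun x => sgn (K n) x * g ((K n).1 x)) μ := by
      refine Integrable.of_bound ((hmeas n).mul hgm).aestronglyMeasurable 1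
        (Eventually.of_forall fun x => ?_)
      have : |sgn (K n) x| = 1 := by simp only [sgn]; split_ifs <;> simp
      rw [norm_mul, Real.norm_eq_abs, Real.norm_eq_abs, this, one_mul]
      exact hg _
    simp only [hgx]
    rw [← integral_add_compl (hEm (K n)) hgi]
    have h₁ : ∫ x in E (K n), sgn (K n) x * g ((K n).1 x) ∂μ =
        ∫ j, g j ∂((μ.restrict (E (K n))).map (K n).1) := by
      rw [integral_map (K n).2.aemeasurable (measurable_from_nat (f := g)).aestronglyMeasurable]
      exact setIntegral_congr_fun (hEm _) fun x hx => by simp [sgn, hx]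
    have h₂ : ∫ x in (E (K n))ᶜ, sgn (K n) x * g ((K n).1 x) ∂μ =
        -∫ j, g j ∂((μ.restrict (E (K n))ᶜ).map (K n).1) := by
      rw [integral_map (K n).2.aemeasurable (measurable_from_nat (f := g)).aestronglyMeasurable,
        ← integral_neg]
      exact setIntegral_congr_fun (hEm _).compl fun x hx => by
        simp [sgn, (Set.mem_compl_iff _ _).1 hx]
    rw [h₁, h₂, hE]
    ring
  refine ⟨fun n => sgn (K n), hmeas, fun n x => ?_, fun n k hnk => ?_⟩
  · simp only [sgn]
    split_ifs <;> simp
  · rcases lt_or_gt_of_ne hnk with h | h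
    · simp only [mul_comm (sgn (K n) _)]
      exact hlt n k h
    · exact hlt k n h

end Nonatomic

/-- An orthogonal sequence of constant norm converges weakly to zero. -/
theorem tendsto_inner_zero_of_orthogonal {H : Type*} [NormedAddCommGroup H]
    [InnerProductSpace ℝ H] {e : ℕ → H} {N : ℝ} (hN : ∀ n, ‖e n‖ = N)
    (horth : ∀ n k, n ≠ k → inner ℝ (e n) (e k) = 0) (g : H) :
    Tendsto (fun n => inner ℝ g (e n)) atTop (𝓝 0) := by
  rcases eq_or_ne N 0 with rfl | hN0
  · simp only [norm_eq_zero] at hN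
    simp [hN]
  have hon : Orthonormal ℝ fun n => N⁻¹ • e n := by
    refine ⟨fun n => ?_, fun n k hnk => ?_⟩
    · have : 0 ≤ N := hN n ▸ norm_nonneg _
      rw [norm_smul, hN, norm_inv, Real.norm_of_nonneg this, inv_mul_cancel₀ hN0]
    · change inner ℝ (N⁻¹ • e n) (N⁻¹ • e k) = 0
      rw [inner_smul_left, inner_smul_right, horth n k hnk, mul_zero, mul_zero]
  -- Bessel's inequality.
  have h := (hon.inner_products_summable g).tendsto_atTop_zero
  have h' : Tendsto (fun n => inner ℝ (N⁻¹ • e n) g) atTop (𝓝 0) := by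
    refine tendsto_zero_iff_norm_tendsto_zero.2 ?_
    simpa [Real.sqrt_sq_eq_abs] using h.sqrt
  have h'' := h'.const_mul N
  rw [mul_zero] at h''
  refine h''.congr fun n => ?_
  rw [real_inner_smul_left, mul_inv_cancel_left₀ hN0, real_inner_comm]

end AffineControl

/-! ### Consequences of stability, and the sufficient condition. -/

namespace AffineControl

variable {X : Type*} [MeasurableSpace X] {μ : Measure X} [IsFiniteMeasure μ] {m : ℕ}
  {U : Set (EuclideanSpace ℝ (Fin m))} {J : feasibleSet μ U → ℝ} {v : feasibleSet μ U} {γ : ℝ≥0}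

theorem norm_sub_le_of_tendsto_weak {E : Type*} [NormedAddCommGroup E] [NormedSpace ℝ E]
    {u : ℕ → E} {w v : E} {r : ℝ} (hu : ∀ n, ‖u n - v‖ ≤ r)
    (h : Tendsto (fun n => toWeakSpace ℝ E (u n)) atTop (𝓝 (toWeakSpace ℝ E w))) :
    ‖w - v‖ ≤ r := by
  have := mem_of_tendsto_weak (convex_closedBall v r) Metric.isClosed_closedBall
    (fun n => mem_closedBall_iff_norm.2 (hu n)) h
  exact mem_closedBall_iff_norm.1 this

/-- Direct method: the tilted objective is weakly sequentially continuous and the ball is weakly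
sequentially compact, so its image in `ℝ` is compact. -/
theorem localizedSolutions_nonempty (hconv : Convex ℝ U) (hU : IsCompact U)
    (hJ : WeaklySeqContinuous J) (v : feasibleSet μ U) (γ : ℝ≥0) (ξ : Linf μ m) :
    (localizedSolutions J v γ ξ).Nonempty := by
  let F : feasibleSet μ U → ℝ := fun u => J u - pairing ξ (u : L1 μ m)
  let B : Set (feasibleSet μ U) := {u | ‖(u : L1 μ m) - v‖ ≤ γ}
  have hseq : IsSeqCompact (F '' B) := by
    intro y hy
    choose u hu hFu using hy
    obtain ⟨w, φ, hφ, hw⟩ := exists_subseq_tendsto_weak hconv hU u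
    refine ⟨F w, ⟨w, norm_sub_le_of_tendsto_weak (fun n => hu (φ n)) hw, rfl⟩, φ, hφ, ?_⟩
    have h := (hJ _ w hw).sub (tendsto_toWeakSpace_iff.1 hw (pairingCLM ξ))
    exact h.congr fun n => hFu (φ n)
  obtain ⟨_, ⟨u, hu, rfl⟩, hmin⟩ := hseq.isCompact.exists_isLeast
    ⟨F v, v, by simp [B], rfl⟩
  exact ⟨u, hu, fun w hw => hmin ⟨w, hw, rfl⟩⟩

/-- The stability property with radius `γ` forces strict minimality on the ball of radius `γ`. -/
theorem StableWithRadius.lt (hst : StableWithRadius J v γ) (hconv : Convex ℝ U)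
    (hU : IsCompact U) (hJ : WeaklySeqContinuous J) (u : feasibleSet μ U) (huv : u ≠ v)
    (hu : ‖(u : L1 μ m) - v‖ ≤ γ) : J v < J u := by
  have huniq : ∀ w ∈ localizedSolutions J v γ (0 : Linf μ m), w = v := by
    intro w hw
    refine Subtype.ext (sub_eq_zero.1 (norm_eq_zero.1 (le_antisymm
      (le_of_forall_pos_lt_add fun ε hε => ?_) (norm_nonneg _))))
    obtain ⟨δ, hδ, h⟩ := hst ε hε
    simpa using h 0 w hw (by simpa using hδ)
  obtain ⟨w, hw⟩ := localizedSolutions_nonempty hconv hU hJ v γ 0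
  have hle : ∀ z : feasibleSet μ U, ‖(z : L1 μ m) - v‖ ≤ γ → J v ≤ J z := by
    have := hw.2
    rw [huniq w hw] at this
    simpa [pairing_zero] using this
  refine lt_of_not_ge fun h => huv (huniq u ⟨hu, fun z hz => ?_⟩)
  simpa only [pairing_zero, sub_zero] using h.trans (hle z hz)

/-- The stability property yields a growth condition for the objective. -/
theorem StableWithRadius.exists_growth (hst : StableWithRadius J v γ) (hconv : Convex ℝ U)
    (hU : IsCompact U) (hJ : WeaklySeqContinuous J) {ε : ℝ} (hε : 0 < ε) :
    ∃ c : ℝ, 0 < c ∧ ∀ u : feasibleSet μ U, ‖(u : L1 μ m) - v‖ ≤ γ →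
      c * (‖(u : L1 μ m) - v‖ - ε) ≤ J u - J v := by
  obtain ⟨δ, hδ, h⟩ := hst ε hε
  refine ⟨δ / 2, half_pos hδ, fun u hu => ?_⟩
  -- This tilt earns `δ / 2 * ‖u - v‖` at `u`, but at most `δ / 2 * ε` more at a solution `w` than
  -- at `v`. Optimality of `w` against `u`, with `J v ≤ J w`, gives the bound.
  obtain ⟨ξ, hξ, hξu⟩ := exists_pairing_eq_mul_norm ((u : L1 μ m) - v : L1 μ m) (half_pos hδ).le
  obtain ⟨w, hw⟩ := localizedSolutions_nonempty hconv hU hJ v γ ξ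
  have h₁ := h ξ w hw (by linarith)
  have h₂ := hw.2 u hu
  have h₃ : J v ≤ J w := by
    by_cases hwv : w = v
    · rw [hwv]
    · exact (hst.lt hconv hU hJ w hwv hw.1).le
  have h₄ : pairing ξ ((w : L1 μ m) - v) ≤ δ / 2 * ε :=
    (le_abs_self _).trans ((abs_pairing_le ξ _).trans
      (mul_le_mul hξ h₁.le (norm_nonneg _) (half_pos hδ).le))
  rw [pairing_sub] at hξu h₄
  linarith

/-- A bang-bang strict minimizer on the ball of radius `γ` has the stability property. -/
theorem IsBangBang.stableWithRadius (hv : IsBangBang v) (hconv : Convex ℝ U)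
    (hU : IsCompact U) (hJ : WeaklySeqContinuous J)
    (hstrict : ∀ u : feasibleSet μ U, u ≠ v → ‖(u : L1 μ m) - v‖ ≤ γ → J v < J u) :
    StableWithRadius J v γ := by
  by_contra hns
  simp only [StableWithRadius] at hns
  push Not at hns
  obtain ⟨ε, hε, hns⟩ := hns
  choose ξ u hu hξ hfar using fun n : ℕ => hns (1 / (n + 1)) Nat.one_div_pos_of_nat
  obtain ⟨w, φ, hφ, hw⟩ := exists_subseq_tendsto_weak hconv hU u
  have hwγ : ‖(w : L1 μ m) - v‖ ≤ γ := norm_sub_le_of_tendsto_weak (fun n => (hu (φ n)).1) hw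
  have hJle : ∀ n, J (u n) ≤ J v + 1 / ((n : ℝ) + 1) * γ := fun n => by
    have h₁ := (hu n).2 v (by simp)
    have h₂ : pairing (ξ n) ((u n : L1 μ m) - v) ≤ 1 / ((n : ℝ) + 1) * γ :=
      (le_abs_self _).trans ((abs_pairing_le _ _).trans
        (mul_le_mul (hξ n).le (hu n).1 (norm_nonneg _) Nat.one_div_pos_of_nat.le))
    rw [pairing_sub] at h₂
    linarith
  have hlim : Tendsto (fun n : ℕ => J v + 1 / ((n : ℝ) + 1) * γ) atTop (𝓝 (J v)) := by
    simpa using (tendsto_one_div_add_atTop_nhds_zero_nat.mul_const (γ : ℝ)).const_add (J v)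
  -- Comparing `u n` with `v` gives `J w ≤ J v` in the limit, so strictness identifies `w`.
  have hwv : w = v := by
    by_contra hne
    exact absurd (le_of_tendsto_of_tendsto' (hJ _ w hw) (hlim.comp hφ.tendsto_atTop)
      fun n => hJle (φ n)) (not_le.2 (hstrict w hne hwγ))
  rw [hwv] at hw
  have := ge_of_tendsto' (tendsto_norm_sub_of_isBangBang hconv hU hv hw) fun n => hfar (φ n)
  linarith

end AffineControl

/-! ### Oscillations along segments, and necessity of the bang-bang property. -/

namespace AffineControl

/-- The centers of the segments of length `2 * ρ` contained in `U`. -/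
def segmentCenters {E : Type*} [NormedAddCommGroup E] (U : Set E) (ρ : ℝ) : Set E :=
  {y | ∃ w : E, ‖w‖ = ρ ∧ y + w ∈ U ∧ y - w ∈ U}

section SegmentCenters

variable {E : Type*} [NormedAddCommGroup E] [NormedSpace ℝ E] {U : Set E}

/-- A projection of a closed set along a compact sphere; closedness makes preimages measurable. -/
theorem isClosed_segmentCenters {E : Type*} [NormedAddCommGroup E] [ProperSpace E] {U : Set E}
    (hU : IsClosed U) (ρ : ℝ) :
    IsClosed (segmentCenters U ρ) := by
  have hK : IsCompact (Metric.sphere (0 : E) ρ) := isCompact_sphere 0 ρ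
  have hS : IsClosed {q : E × Metric.sphere (0 : E) ρ | q.1 + q.2 ∈ U ∧ q.1 - q.2 ∈ U} :=
    (hU.preimage (by fun_prop)).inter (hU.preimage (by fun_prop))
  have : CompactSpace (Metric.sphere (0 : E) ρ) := isCompact_iff_compactSpace.1 hK
  have e : segmentCenters U ρ =
      Prod.fst '' {q : E × Metric.sphere (0 : E) ρ | q.1 + q.2 ∈ U ∧ q.1 - q.2 ∈ U} := by
    ext y
    constructor
    · rintro ⟨w, hw, h⟩
      exact ⟨(y, ⟨w, by simpa using hw⟩), h, rfl⟩
    · rintro ⟨⟨y, w⟩, h, rfl⟩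
      exact ⟨w, by simp, h⟩
  rw [e]
  exact isClosedMap_fst_of_compactSpace _ hS

theorem segmentCenters_subset (hconv : Convex ℝ U) (ρ : ℝ) : segmentCenters U ρ ⊆ U := by
  rintro y ⟨w, -, h₁, h₂⟩
  have := hconv h₁ h₂ (a := 1 / 2) (b := 1 / 2) (by norm_num) (by norm_num) (by norm_num)
  convert! this using 1
  module

theorem segmentCenters_anti (hconv : Convex ℝ U) {ρ ρ' : ℝ} (h0 : 0 ≤ ρ) (h : ρ ≤ ρ') :
    segmentCenters U ρ' ⊆ segmentCenters U ρ := by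
  rcases (h0.trans h).eq_or_lt with h' | hpos
  · rw [show ρ = ρ' by linarith]
  intro y hy
  have hyU := segmentCenters_subset hconv _ hy
  obtain ⟨w, hw, h₁, h₂⟩ := hy
  have ht0 : 0 ≤ ρ / ρ' := by positivity
  have ht1 : ρ / ρ' ≤ 1 := (div_le_one hpos).2 h
  refine ⟨(ρ / ρ') • w, ?_, ?_, ?_⟩
  · rw [norm_smul, hw, Real.norm_of_nonneg ht0, div_mul_cancel₀ _ hpos.ne']
  · convert! hconv hyU h₁ (sub_nonneg.2 ht1) ht0 (by ring) using 1
    module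
  · convert! hconv hyU h₂ (sub_nonneg.2 ht1) ht0 (by ring) using 1
    module

theorem exists_mem_segmentCenters (hconv : Convex ℝ U) {y : E} (hy : y ∈ U)
    (hne : y ∉ U.extremePoints ℝ) : ∃ ρ : ℝ, 0 < ρ ∧ y ∈ segmentCenters U ρ := by
  have : ∃ x₁ ∈ U, ∃ x₂ ∈ U, y ∈ openSegment ℝ x₁ x₂ ∧ x₁ ≠ x₂ := by
    by_contra! hcon
    refine hne (mem_extremePoints.2 ⟨hy, fun x₁ h₁ x₂ h₂ hseg => ?_⟩)
    have e := hcon x₁ h₁ x₂ h₂ hseg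
    subst e
    rw [openSegment_same] at hseg
    exact ⟨hseg.symm, hseg.symm⟩
  obtain ⟨x₁, h₁, x₂, h₂, ⟨a, b, ha, hb, hab, rfl⟩, hx⟩ := this
  -- With this factor, moving from `a • x₁ + b • x₂` along `±(x₁ - x₂)` keeps both coefficients
  -- nonnegative.
  have hmin : 0 < min a b := lt_min ha hb
  refine ⟨‖min a b • (x₁ - x₂)‖, norm_pos_iff.2 (smul_ne_zero hmin.ne' (sub_ne_zero.2 hx)),
    min a b • (x₁ - x₂), rfl, ?_, ?_⟩
  · convert! hconv h₁ h₂ (a := a + min a b) (b := b - min a b) (by linarith)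
      (sub_nonneg.2 (min_le_right _ _)) (by linarith) using 1
    module
  · convert! hconv h₁ h₂ (a := a - min a b) (b := b + min a b) (sub_nonneg.2 (min_le_left _ _))
      (by linarith) (by linarith) using 1
    module

end SegmentCenters

variable {X : Type*} [MeasurableSpace X] {μ : Measure X} [IsFiniteMeasure μ] {m : ℕ}
  {U : Set (EuclideanSpace ℝ (Fin m))} {J : feasibleSet μ U → ℝ} {v : feasibleSet μ U} {γ : ℝ≥0}

/-- Oscillating sequences: on a nonatomic space, suitable sign changes of `w` converge weakly to
zero. -/
theorem Nonatomic.exists_oscillation (hμ : Nonatomic μ) {A : Set X} (hA : MeasurableSet A)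
    {w : X → EuclideanSpace ℝ (Fin m)} (hw : Measurable w) {ρ : ℝ} (hwρ : ∀ x, ‖w x‖ = ρ) :
    ∃ e : ℕ → L1 μ m, Tendsto (fun n => toWeakSpace ℝ (L1 μ m) (e n)) atTop
        (𝓝 (toWeakSpace ℝ (L1 μ m) 0)) ∧
      (∀ n, ‖e n‖ = ρ * μ.real A) ∧
      ∀ n, ∀ᵐ x ∂μ, (x ∈ A → e n x = w x ∨ e n x = -w x) ∧ (x ∉ A → e n x = 0) := by
  obtain ⟨r, hrm, hr, horth⟩ := (hμ.restrict hA).exists_orthogonal_signs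
  let f : ℕ → X → EuclideanSpace ℝ (Fin m) := fun n => A.indicator fun x => r n x • w x
  have hrn : ∀ n x, ‖r n x • w x‖ = ρ := fun n x => by
    rw [norm_smul, hwρ]
    rcases hr n x with h | h <;> simp [h]
  have hfm : ∀ n, AEStronglyMeasurable (f n) μ := fun n =>
    (((hrm n).smul hw).indicator hA).aestronglyMeasurable
  have hf : ∀ n, MemLp (f n) 2 μ := fun n => MemLp.of_bound (hfm n) ρ <|
    Eventually.of_forall fun x => (norm_indicator_le_norm_self _ _).trans (hrn n x).le
  -- Since `‖w x‖` is constant, orthogonality of the signs passes to the functions `f n`.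
  have hin : ∀ n k, inner ℝ ((hf n).toLp (f n)) ((hf k).toLp (f k)) =
      ρ ^ 2 * ∫ x in A, r n x * r k x ∂μ := fun n k => by
    rw [L2.inner_def, ← integral_const_mul, ← integral_indicator hA]
    refine integral_congr_ae ?_
    filter_upwards [(hf n).coeFn_toLp, (hf k).coeFn_toLp] with x h₁ h₂
    rw [h₁, h₂]
    by_cases hx : x ∈ A
    · simp only [f, Set.indicator_of_mem hx, real_inner_smul_left, real_inner_smul_right,
        real_inner_self_eq_norm_sq, hwρ]
      ring
    · simp [f, Set.indicator_of_notMem hx]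
  have hnorm : ∀ n, ‖(hf n).toLp (f n)‖ = √(ρ ^ 2 * μ.real A) := fun n => by
    rw [@norm_eq_sqrt_real_inner, hin]
    have : ∀ x, r n x * r n x = 1 := fun x => by rcases hr n x with h | h <;> simp [h]
    simp [this]
  have hweak := tendsto_weak_lpTwoToLpOne (l := atTop) (u := fun n => (hf n).toLp (f n)) (v := 0)
      fun g => by
    rw [inner_zero_right]
    exact tendsto_inner_zero_of_orthogonal hnorm
      (fun n k hnk => by rw [hin, horth n k hnk, mul_zero]) g
  rw [map_zero] at hweak
  have hae : ∀ n, lpTwoToLpOne μ _ ((hf n).toLp (f n)) =ᵐ[μ] f n := fun n =>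
    (coeFn_lpTwoToLpOne _).trans (hf n).coeFn_toLp
  refine ⟨_, hweak, fun n => ?_, fun n => ?_⟩
  · rw [L1.norm_eq_integral_norm]
    have : ∫ x, ‖lpTwoToLpOne μ _ ((hf n).toLp (f n)) x‖ ∂μ = ∫ x in A, ρ ∂μ := by
      rw [← integral_indicator hA]
      refine integral_congr_ae ?_
      filter_upwards [hae n] with x hx
      rw [hx]
      by_cases hxA : x ∈ A
      · simp only [f, Set.indicator_of_mem hxA, hrn]
      · simp [f, Set.indicator_of_notMem hxA]
    rw [this, setIntegral_const, smul_eq_mul, mul_comm]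
  · filter_upwards [hae n] with x hx
    rw [hx]
    refine ⟨fun hxA => ?_, fun hxA => Set.indicator_of_notMem hxA _⟩
    simp only [f, Set.indicator_of_mem hxA]
    rcases hr n x with h | h <;> simp [h]

/-- The center sets grow as `ρ` decreases and exhaust the nonextreme points of `U`; were they all to
have null preimage, `v` would be bang-bang. -/
theorem exists_measure_preimage_segmentCenters_pos (hconv : Convex ℝ U)
    (hv : ¬IsBangBang v) :
    ∃ ρ₀ : ℝ, 0 < ρ₀ ∧ ∀ ρ, 0 < ρ → ρ ≤ ρ₀ →
      0 < μ.real ((v : L1 μ m) ⁻¹' segmentCenters U ρ) := by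
  by_contra! hcon
  have hnull : ∀ n : ℕ, μ ((v : L1 μ m) ⁻¹' segmentCenters U (1 / ((n : ℝ) + 1))) = 0 := by
    intro n
    obtain ⟨ρ, hρ, hle, h0⟩ := hcon (1 / ((n : ℝ) + 1)) Nat.one_div_pos_of_nat
    refine measure_mono_null (Set.preimage_mono (segmentCenters_anti hconv hρ.le hle)) ?_
    exact (measureReal_eq_zero_iff).1 (le_antisymm h0 measureReal_nonneg)
  apply hv
  have hvU : ∀ᵐ x ∂μ, (v : L1 μ m) x ∈ U := v.2
  have hall : ∀ᵐ x ∂μ, ∀ n : ℕ, (v : L1 μ m) x ∉ segmentCenters U (1 / ((n : ℝ) + 1)) :=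
    ae_all_iff.2 fun n => measure_eq_zero_iff_ae_notMem.1 (hnull n)
  filter_upwards [hvU, hall] with x h₁ h₂
  by_contra hne
  obtain ⟨ρ, hρ, hmem⟩ := exists_mem_segmentCenters hconv h₁ hne
  obtain ⟨n, hn⟩ := exists_nat_one_div_lt hρ
  exact h₂ n (segmentCenters_anti hconv Nat.one_div_pos_of_nat.le hn.le hmem)

/-- Approximation of a feasible function by feasible functions that are centers of feasible
oscillations of amplitude `ρ`. -/
theorem exists_approximation_with_amplitude (hconv : Convex ℝ U) (hU : IsCompact U) {ρ : ℝ}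
    (hpos : 0 < μ.real ((v : L1 μ m) ⁻¹' segmentCenters U ρ)) :
    ∃ (s : ℕ → feasibleSet μ U) (w : ℕ → X → EuclideanSpace ℝ (Fin m)),
      Tendsto (fun N => (s N : L1 μ m)) atTop (𝓝 (v : L1 μ m)) ∧
      (∀ N, Measurable (w N)) ∧ (∀ N x, ‖w N x‖ = ρ) ∧
      ∀ N, ∀ᵐ x ∂μ, x ∈ (v : L1 μ m) ⁻¹' segmentCenters U ρ →
        (s N : L1 μ m) x + w N x ∈ U ∧ (s N : L1 μ m) x - w N x ∈ U := by
  classical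
  set C := segmentCenters U ρ
  set A : Set X := (v : L1 μ m) ⁻¹' C
  have hvm : Measurable (v : L1 μ m) := (Lp.stronglyMeasurable _).measurable
  have hA : MeasurableSet A := hvm (isClosed_segmentCenters hU.isClosed ρ).measurableSet
  obtain ⟨x₀, hx₀⟩ : A.Nonempty := Set.nonempty_iff_ne_empty.2 fun h => by simp [h] at hpos
  have hW : ∀ y ∈ C, ∃ w, ‖w‖ = ρ ∧ y + w ∈ U ∧ y - w ∈ U := fun y hy => hy
  choose! W hWn hWU using hW
  obtain ⟨R, hR⟩ := hU.isBounded.exists_norm_le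
  -- Off `A`, the value at `x₀` keeps `f` inside `C`, so that the half-segment `W` has length `ρ`
  -- everywhere.
  let f : X → EuclideanSpace ℝ (Fin m) := A.piecewise (v : L1 μ m) fun _ => (v : L1 μ m) x₀
  have hf : Measurable f := Measurable.piecewise hA hvm measurable_const
  have hfC : ∀ x, f x ∈ C := fun x => by
    by_cases hx : x ∈ A
    · simp only [f, Set.piecewise_eq_of_mem _ _ _ hx]
      exact hx
    · simp only [f, Set.piecewise_eq_of_notMem _ _ _ hx]
      exact hx₀
  -- Simple functions avoid a measurable selection: an arbitrary choice `W` composed with a simple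
  -- function is measurable.
  let σ : ℕ → SimpleFunc X (EuclideanSpace ℝ (Fin m)) :=
    SimpleFunc.approxOn f hf C ((v : L1 μ m) x₀) hx₀
  have hσ : ∀ N x, σ N x ∈ C := SimpleFunc.approxOn_mem hf hx₀
  have hCR : ∀ y ∈ C, ‖y‖ ≤ R := fun y hy => hR y (segmentCenters_subset hconv ρ hy)
  have hσlim : Tendsto (fun N => eLpNorm (⇑(σ N) - f) 1 μ) atTop (𝓝 0) := by
    refine SimpleFunc.tendsto_approxOn_Lp_eLpNorm hf hx₀ ENNReal.one_ne_top
      (Eventually.of_forall fun x => subset_closure (hfC x)) ?_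
    refine (MemLp.of_bound (hf.sub_const _).aestronglyMeasurable (R + R)
      (Eventually.of_forall fun x => ?_)).2
    exact (norm_sub_le _ _).trans (add_le_add (hCR _ (hfC x)) (hCR _ hx₀))
  let g : ℕ → X → EuclideanSpace ℝ (Fin m) := fun N => A.piecewise (σ N) (v : L1 μ m)
  have hgm : ∀ N, Measurable (g N) := fun N => Measurable.piecewise hA (σ N).measurable hvm
  have hvU : ∀ᵐ x ∂μ, (v : L1 μ m) x ∈ U := v.2
  have hgU : ∀ N, ∀ᵐ x ∂μ, g N x ∈ U := fun N => by
    filter_upwards [hvU] with x hx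
    by_cases hxA : x ∈ A
    · simpa only [g, Set.piecewise_eq_of_mem _ _ _ hxA] using
        segmentCenters_subset hconv ρ (hσ N x)
    · simpa only [g, Set.piecewise_eq_of_notMem _ _ _ hxA] using hx
  have hg : ∀ N, MemLp (g N) 1 μ := fun N =>
    MemLp.of_bound (hgm N).aestronglyMeasurable R ((hgU N).mono fun x hx => hR _ hx)
  have hgs : ∀ N, (hg N).toLp (g N) ∈ feasibleSet μ U := fun N => by
    change ∀ᵐ x ∂μ, (hg N).toLp (g N) x ∈ U
    filter_upwards [hgU N, (hg N).coeFn_toLp] with x h₁ h₂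
    rwa [h₂]
  refine ⟨fun N => ⟨_, hgs N⟩, fun N x => W (σ N x), ?_, fun N => ((σ N).map W).measurable,
    fun N x => hWn _ (hσ N x), fun N => ?_⟩
  · refine tendsto_iff_norm_sub_tendsto_zero.2 ?_
    have hb : ∀ N, ‖(hg N).toLp (g N) - (v : L1 μ m)‖ ≤ (eLpNorm (⇑(σ N) - f) 1 μ).toReal := by
      intro N
      have hne : eLpNorm (⇑(σ N) - f) 1 μ ≠ ∞ := by
        refine (MemLp.of_bound (((σ N).measurable.sub hf).aestronglyMeasurable) (R + R)
          (Eventually.of_forall fun x => ?_)).2.ne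
        exact (norm_sub_le _ _).trans (add_le_add (hCR _ (hσ N x)) (hCR _ (hfC x)))
      rw [Lp.norm_def]
      refine ENNReal.toReal_mono hne (eLpNorm_mono_ae ?_)
      filter_upwards [Lp.coeFn_sub ((hg N).toLp (g N)) (v : L1 μ m), (hg N).coeFn_toLp]
        with x h₁ h₂
      rw [h₁, Pi.sub_apply, h₂, Pi.sub_apply]
      by_cases hxA : x ∈ A
      · simp only [g, f, Set.piecewise_eq_of_mem _ _ _ hxA, le_refl]
      · simp only [g, Set.piecewise_eq_of_notMem _ _ _ hxA, sub_self, norm_zero, norm_nonneg]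
    refine squeeze_zero (fun N => norm_nonneg _) hb ?_
    simpa [Function.comp_def] using (ENNReal.tendsto_toReal ENNReal.zero_ne_top).comp hσlim
  · filter_upwards [(hg N).coeFn_toLp] with x hx hxA
    simp only [hx, g, Set.piecewise_eq_of_mem _ _ _ hxA]
    exact hWU _ (hσ N x)

/-- On a nonatomic space, stability implies the bang-bang property. -/
theorem StableWithRadius.isBangBang (hst : StableWithRadius J v γ) (hγ : 0 < γ)
    (hμ : Nonatomic μ) (hconv : Convex ℝ U) (hU : IsCompact U) (hJ : WeaklySeqContinuous J) :
    IsBangBang v := by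
  by_contra hv
  obtain ⟨ρ₀, hρ₀, hpos⟩ := exists_measure_preimage_segmentCenters_pos hconv hv
  -- The amplitude is small enough that the oscillation norm `a` is at most `γ / 2`, leaving room in
  -- the ball for the approximation error `a / 4`.
  obtain ⟨ρ, hρ, hρle, hργ⟩ : ∃ ρ : ℝ, 0 < ρ ∧ ρ ≤ ρ₀ ∧ ρ * (μ.real Set.univ + 1) ≤ γ / 2 := by
    have hγ' : (0 : ℝ) < γ := hγ
    have hM : 0 < μ.real Set.univ + 1 := by positivity
    refine ⟨min ρ₀ (γ / 2 / (μ.real Set.univ + 1)), lt_min hρ₀ (by positivity), min_le_left _ _, ?_⟩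
    exact (le_div_iff₀ hM).1 (min_le_right _ _)
  have hA := hpos ρ hρ hρle
  obtain ⟨s, w, hs, hwm, hwρ, hsw⟩ := exists_approximation_with_amplitude hconv hU hA
  set A : Set X := (v : L1 μ m) ⁻¹' segmentCenters U ρ
  have hAm : MeasurableSet A := (Lp.stronglyMeasurable (v : L1 μ m)).measurable
    (isClosed_segmentCenters hU.isClosed ρ).measurableSet
  set a : ℝ := ρ * μ.real A
  have hapos : 0 < a := mul_pos hρ hA
  have haγ : a ≤ γ / 2 := by
    refine le_trans ?_ hργ
    have : μ.real A ≤ μ.real Set.univ := measureReal_mono (Set.subset_univ _)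
    exact mul_le_mul_of_nonneg_left (by linarith) hρ.le
  obtain ⟨c, hc, hgrowth⟩ := hst.exists_growth hconv hU hJ (half_pos hapos)
  have hJs : Tendsto (fun N => J (s N)) atTop (𝓝 (J v)) :=
    hJ _ v (((toWeakSpaceCLM ℝ (L1 μ m)).continuous.tendsto _).comp hs)
  have hclose : ∀ᶠ N in atTop, ‖(s N : L1 μ m) - v‖ < a / 4 :=
    (tendsto_iff_norm_sub_tendsto_zero.1 hs).eventually (gt_mem_nhds (by positivity))
  -- For fixed `N`, the oscillating functions are at distance at least `3 * a / 4` from `v`. Growth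
  -- with `ε = a / 2` yields the gain `c * (a / 4)`, which survives first the limit in `n`, then
  -- that in `N`.
  have hbig : ∀ᶠ N in atTop, J v + c * (a / 4) ≤ J (s N) := by
    filter_upwards [hclose] with N hN
    obtain ⟨e, he, hen, heA⟩ := hμ.exists_oscillation hAm (hwm N) (hwρ N)
    have hfeas : ∀ n, (s N : L1 μ m) + e n ∈ feasibleSet μ U := fun n => by
      change ∀ᵐ x ∂μ, ((s N : L1 μ m) + e n) x ∈ U
      have hsU : ∀ᵐ x ∂μ, (s N : L1 μ m) x ∈ U := (s N).2
      filter_upwards [hsU, hsw N, heA n, Lp.coeFn_add (s N : L1 μ m) (e n)] with x h₁ h₂ h₃ h₄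
      rw [h₄, Pi.add_apply]
      by_cases hxA : x ∈ A
      · rcases h₃.1 hxA with h | h
        · rw [h]
          exact (h₂ hxA).1
        · rw [h, ← sub_eq_add_neg]
          exact (h₂ hxA).2
      · rw [h₃.2 hxA, add_zero]
        exact h₁
    have hlim : Tendsto (fun n => J ⟨_, hfeas n⟩) atTop (𝓝 (J (s N))) := by
      refine hJ _ _ (tendsto_toWeakSpace_iff.2 fun l => ?_)
      have := (tendsto_toWeakSpace_iff.1 he l).const_add (l (s N : L1 μ m))
      simpa only [map_add, map_zero, add_zero] using this
    refine ge_of_tendsto' hlim fun n => ?_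
    have e₁ : (s N : L1 μ m) + e n - v = e n + ((s N : L1 μ m) - v) := by abel
    have h₁ : ‖(s N : L1 μ m) + e n - v‖ ≤ γ := by
      rw [e₁]
      refine (norm_add_le _ _).trans ?_
      rw [hen]
      linarith
    have h₂ : 3 * a / 4 ≤ ‖(s N : L1 μ m) + e n - v‖ := by
      rw [e₁]
      have := norm_sub_norm_le (e n) (-((s N : L1 μ m) - v))
      rw [norm_neg, sub_neg_eq_add, hen] at this
      linarith
    have h₃ := hgrowth ⟨_, hfeas n⟩ h₁
    simp only at h₃
    nlinarith
  have := ge_of_tendsto hJs hbig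
  have : 0 < c * (a / 4) := by positivity
  linarith

end AffineControl

/-! ### The equivalence and the equality of radii. -/

theorem theorem4p8 {X : Type*} [MeasurableSpace X] (μ : Measure X) [IsFiniteMeasure μ]
    (hμ : AffineControl.Nonatomic μ) {m : ℕ} (U : Set (EuclideanSpace ℝ (Fin m)))
    (hUconv : Convex ℝ U) (hUcomp : IsCompact U) (hUnt : U.Nontrivial)
    (J : AffineControl.feasibleSet μ U → ℝ) (hJ : AffineControl.WeaklySeqContinuous J)
    (ustar : AffineControl.feasibleSet μ U) (hmin : AffineControl.IsLocalMinimizer J ustar) :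
    (AffineControl.IsLocallyStable J ustar ↔
      AffineControl.IsBangBang ustar ∧ AffineControl.IsStrictLocalMinimizer J ustar) ∧
    (AffineControl.IsLocallyStable J ustar →
      AffineControl.stabilityRadius J ustar = AffineControl.strictMinimalityRadius J ustar) := by
  have hle : AffineControl.stabilityRadius J ustar ≤
      AffineControl.strictMinimalityRadius J ustar :=
    iSup₂_le fun γ hγ => le_iSup₂_of_le γ (hγ.2.lt hUconv hUcomp hJ) le_rfl
  have hbb : AffineControl.IsLocallyStable J ustar → AffineControl.IsBangBang ustar :=
    fun ⟨γ, hγ, hst⟩ => hst.isBangBang hγ hμ hUconv hUcomp hJ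
  refine ⟨⟨fun h => ⟨hbb h, ?_⟩, fun ⟨hv, hs⟩ => ?_⟩, fun h => hle.antisymm ?_⟩
  · obtain ⟨γ, hγ⟩ := h
    exact lt_of_lt_of_le (ENNReal.coe_pos.2 hγ.1) ((le_iSup₂_of_le γ hγ le_rfl).trans hle)
  · obtain ⟨γ, hγ⟩ := lt_iSup_iff.1 hs
    obtain ⟨hst, hγ⟩ := lt_iSup_iff.1 hγ
    exact ⟨γ, ENNReal.coe_pos.1 hγ, hv.stableWithRadius hUconv hUcomp hJ hst⟩
  · refine iSup₂_le fun γ hγ => ?_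
    -- The stability radius ranges over positive `γ` only, so zero is separate.
    rcases eq_or_ne γ 0 with rfl | h0
    · simp
    · exact le_iSup₂_of_le γ ⟨pos_iff_ne_zero.2 h0,
        (hbb h).stableWithRadius hUconv hUcomp hJ hγ⟩ le_rfl
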